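/- Let $L=(L_t)_{t\ge 0}$ be a Lévy subordinator: a real-valued process with $L_0=0$, independent and stationary increments and almost surely nondecreasing right-continuous paths. A structure function on $n\ge 1$ components is a map $\Phi:\{0,1\}^n\to\{0,1\}$; it is coherent if it is nondecreasing in each coordinate and depends on every coordinate. A mixed coherent system of size $n$ is a random structure function $\Phi$ that is (almost surely) coherent. Its signature $s=(s_1,\dots,s_n)$ is $s_k=\phi_{n-k+1}-\phi_{n-k}$, where $\phi_j=\binom nj^{-1}\sum_{x\in\{0,1\}^n,\ |x|=j}\mathbb E\,\Phi(x)$; it is a vector of the simplex $\Delta^n$. If the components fail at times $T_1,\dots,T_n\in[0,\infty]$, with $(T_1,\dots,T_n)$ independent of $\Phi$, the system failure time is $T_{\rm sys}=\inf\{t\ge 0:\Phi(\mathbf 1_{\{T_1>t\}},\dots,\mathbf 1_{\{T_n>t\}})=0\}$. The vector $(T_1,\dots,T_n)$ has the Lévy-frailty Marshall–Olkin distribution with underlying subordinator $L$ if it is distributed as $(\inf\{t\ge 0:L_t>\varepsilon_i\})_{i=1,\dots,n}$ with $\varepsilon_1,\dots,\varepsilon_n$ iid standard exponential and independent of $L$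 (with $\inf\emptyset=\infty$). For each $n\ge 1$ consider a mixed coherent system of size $n$, with signature $s^{(n)}$, whose component failure times have the Lévy-frailty Marshall–Olkin distribution with underlying subordinator $L$ (the same for all $n$), and let $T^{(n)}_{\rm sys}$ be its failure time. Assume: (C) there is a measurable function $f:\mathbb R\to\mathbb R$, vanishing outside $(0,1)$, such that $n\,s^{(n)}_{\lceil nq\rceil}\to f(q)$ as $n\to\infty$ for all $q\in(0,1)$; (D) there is a measurable function $g$ with $\int_0^1 g(q)\,\mathrm dq<\infty$ such that $\sup_{n\ge1}n\,s^{(n)}_{\lceil nq\rceil}\le g(q)$ for all $q\in(0,1)$. Then $f$ is a probability density, and (on a possibly extended probability space) there is a random variable $Q$ with density $f$ that is independent of $L$. Any such $Q$ takes values in $(0,1)$ almost surely, and for all $t>0$, as $n\to\infty$, $$\mathbb P\big(T^{(n)}_{\rm sys}>t\big)\longrightarrow \mathbb P\big(\tau_{-\log(1-Q)}>t\big)=\mathbb P\big(L_t<-\log(1-Q)\big),$$ where $\tau_b:=\inf\{t>0:L_t>b\}$. In particular, $T^{(n)}_{\rm sys}$ converges in distribution to $\tau_{-\log(1-Q)}$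 (as random variables with values in $[0,\infty]$). -/

import Mathlib

open MeasureTheory ProbabilityTheory Filter Topology Set
open scoped ENNReal NNReal

universe u v w

namespace Reliability

/-! ### Coherent and mixed coherent systems -/

/-- The structure function of a system with `n` components. The configuration `x : Fin n → Bool`
has `x i = true` iff component `i` works, and the value `true` means that the system works. -/
abbrev StructureFunction (n : ℕ) : Type := (Fin n → Bool) → Bool

/-- Component `i` is irrelevant: its state never changes the state of the system. -/
def IsIrrelevant {n : ℕ} (Φ : StructureFunction n) (i : Fin n) : Prop :=
  ∀ x : Fin n → Bool, Φ (Function.update x i false) = Φ (Function.update x i true)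

/-- A coherent system: monotone and without irrelevant components. -/
structure IsCoherent {n : ℕ} (Φ : StructureFunction n) : Prop where
  monotone : ∀ (i : Fin n) (x : Fin n → Bool),
    Φ (Function.update x i false) ≤ Φ (Function.update x i true)
  no_irrelevant : ∀ i : Fin n, ¬ IsIrrelevant Φ i

/-- A mixed coherent system: the structure function is chosen at random among the (finitely many)
structure functions of coherent systems. -/
structure IsMixedCoherent {Ω : Type*} [MeasurableSpace Ω] (P : Measure Ω) {n : ℕ}
    (Φ : Ω → StructureFunction n) : Prop where
  measurable : Measurable Φ
  coherent : ∀ᵐ ω ∂P, IsCoherent (Φ ω)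

/-- `φ_j`: the expected proportion, among the configurations with exactly `j` working components,
of those in which the system works. -/
noncomputable def workingProportion {Ω : Type*} [MeasurableSpace Ω] (P : Measure Ω) {n : ℕ}
    (Φ : Ω → StructureFunction n) (j : ℕ) : ℝ :=
  (∑ x : Fin n → Bool with (Finset.univ.filter fun i => x i = true).card = j,
    ∫ ω, (if Φ ω x = true then (1 : ℝ) else 0) ∂P) / (n.choose j : ℝ)

/-- The `k`-th entry `s_k = φ_{n-k+1} - φ_{n-k}` of the signature of a mixed coherent system with
`n` components; meaningful for `1 ≤ k ≤ n`. -/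
noncomputable def signature {Ω : Type*} [MeasurableSpace Ω] (P : Measure Ω) {n : ℕ}
    (Φ : Ω → StructureFunction n) (k : ℕ) : ℝ :=
  workingProportion P Φ (n - k + 1) - workingProportion P Φ (n - k)

/-- The failure time of the system with structure function `Φ` whose components fail at the times
`T i`: the first time at which the configuration of the components that are still working
(those with `t < T i`) makes the system fail. -/
noncomputable def systemFailureTime {n : ℕ} (Φ : StructureFunction n) (T : Fin n → ℝ≥0∞) : ℝ≥0∞ :=
  ⨅ (t : ℝ≥0) (_ : Φ (fun i => decide ((t : ℝ≥0∞) < T i)) = false), (t : ℝ≥0∞)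

/-! ### Lévy subordinators and the Lévy-frailty Marshall-Olkin distribution -/

/-- A Lévy subordinator: a real process started at `0`, with independent and stationary increments
and with almost surely nondecreasing, right-continuous paths (left limits then exist). -/
structure IsLevySubordinator {Ω : Type*} [MeasurableSpace Ω] (P : Measure Ω)
    (L : ℝ≥0 → Ω → ℝ) : Prop where
  measurable : ∀ t, Measurable (L t)
  start_zero : ∀ᵐ ω ∂P, L 0 ω = 0
  indep_increments : HasIndepIncrements L P
  stationary_increments : ∀ s h : ℝ≥0,
    IdentDistrib (fun ω => L (s + h) ω - L s ω) (fun ω => L h ω - L 0 ω) P P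
  monotone_paths : ∀ᵐ ω ∂P, Monotone fun t => L t ω
  right_continuous : ∀ᵐ ω ∂P, ∀ t, ContinuousWithinAt (fun s => L s ω) (Ici t) t

/-- `inf {t ≥ 0 : ℓ t > ε}`, the failure time of a component with trigger `ε` under the path `ℓ`
(`∞` if the path never exceeds `ε`). -/
noncomputable def componentFailureTime (ℓ : ℝ≥0 → ℝ) (ε : ℝ) : ℝ≥0∞ :=
  ⨅ (t : ℝ≥0) (_ : ε < ℓ t), (t : ℝ≥0∞)

/-- `τ_b = inf {t > 0 : ℓ t > b}`, the first passage time of the path `ℓ` across the value `b`. -/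
noncomputable def firstPassageTime (ℓ : ℝ≥0 → ℝ) (b : ℝ) : ℝ≥0∞ :=
  ⨅ (t : ℝ≥0) (_ : 0 < t ∧ b < ℓ t), (t : ℝ≥0∞)

/-- The random vector `T` has the Lévy-frailty Marshall-Olkin distribution with underlying
subordinator `L`: it is distributed as the vector `inf {t ≥ 0 : L_t > ε_i}`, where the triggers
`ε_1, …, ε_n` are iid standard exponential and independent of `L`. -/
def HasLFMODistribution {Ω Ω' : Type*} [MeasurableSpace Ω] [MeasurableSpace Ω']
    (P : Measure Ω) (L : ℝ≥0 → Ω → ℝ) (P' : Measure Ω') {n : ℕ} (T : Ω' → Fin n → ℝ≥0∞) : Prop :=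
  IdentDistrib T
    (fun (p : Ω × (Fin n → ℝ)) (i : Fin n) => componentFailureTime (fun t => L t p.1) (p.2 i))
    P' (P.prod (Measure.pi fun _ : Fin n => expMeasure 1))

/-- On the extension `π : Ω' → Ω` of the probability space `(Ω, P)`, the real random variable `Q`
has density `f` and is independent of the process `L` (seen on the extension as `L ∘ π`). -/
structure IsIndepWithDensity {Ω Ω' : Type*} [MeasurableSpace Ω] [MeasurableSpace Ω']
    (P : Measure Ω) (L : ℝ≥0 → Ω → ℝ) (f : ℝ → ℝ)
    (P' : Measure Ω') (π : Ω' → Ω) (Q : Ω' → ℝ) : Prop where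
  extension : MeasurePreserving π P' P
  density : HasLaw Q (volume.withDensity fun q => ENNReal.ofReal (f q)) P'
  indep : IndepFun (fun ω t => L t (π ω)) Q P'

end Reliability

open Reliability

/-!
Given the subordinator `L`, the components fail independently, each working at time `t` with
probability `p = exp (-L_t)` (the trigger `ε_i` exceeds `L_t`; ties are null because the exponential
law has no atoms). Since a monotone system works at time `t` iff its failure time exceeds `t`,
grouping the configurations by their number of working components gives
`P(T_sys > t) = E[∑_k C(n,k) p^k (1-p)^(n-k) φ_k]`: the expectation of the Bernstein polynomial of the
working proportions `φ_k` at the random point `p` (`measure_lt_systemFailureTime`).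

The step function `h_n(q) = n s_⌈nq⌉` satisfies `φ_j = ∫_{1-j/n}^1 h_n` by telescoping
(`integral_natCeil_step`), and it is nonnegative because the working proportions increase with `j`,
a form of the local Lubell–Yamamoto–Meshalkin inequality (`detWorkingProportion_le_succ`). Hence
`0 ≤ h_n ≤ g`, and dominated convergence gives `∫ |h_n - f| → 0`. It follows that `f` is a
probability density, and that `φ_j` differs from `G(j/n)`, where `G(x) = ∫_{1-x}^1 f`, by at most
`∫ |h_n - f|`, uniformly in `j`. The function `G` is continuous, so Bernstein's theorem shows that the
above polynomials converge to `G` uniformly on `[0, 1]`, and `P(T_sys > t) → E[G(exp (-L_t))]`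
(`DominatedSignatures.tendsto_integral_bernstein`).

If `Q` has density `f` and is independent of `L`, then `E[G(exp (-L_t))]` is the probability of
`Q > 1 - exp (-L_t)`, that is of `L_t < -log (1 - Q)`, and by right-continuity of the paths this event
agrees with `τ_{-log (1 - Q)} > t` up to the null event `L_t = -log (1 - Q)`. Convergence of the tail
probabilities at every `t > 0` yields convergence in distribution on `[0, ∞]` by inclusion-exclusion
over intervals (`tendstoInDistribution_of_tendsto_tail`).
-/

namespace Reliability

/-! ### Working proportions and signatures -/

section Combinatorics

variable {n : ℕ}

/-- The configuration in which exactly the components in `s` work. -/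
def configuration (s : Finset (Fin n)) : Fin n → Bool := fun i => decide (i ∈ s)

lemma configuration_filter (x : Fin n → Bool) :
    configuration (Finset.univ.filter fun i => x i = true) = x := by
  funext i
  simp [configuration]

lemma filter_configuration (s : Finset (Fin n)) :
    (Finset.univ.filter fun i => configuration s i = true) = s := by
  ext i
  simp [configuration]

/-- Monotonicity in each coordinate separately gives monotonicity for the product order. -/
lemma IsCoherent.monotone_apply {Φ : StructureFunction n} (h : IsCoherent Φ) : Monotone Φ := by
  intro x y hxy
  -- Switch on the components of `y` one at a time.
  have key : ∀ s : Finset (Fin n), Φ x ≤ Φ (fun i => if i ∈ s then y i else x i) := by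
    intro s
    induction s using Finset.induction_on with
    | empty => simp
    | insert a s ha ih =>
      refine ih.trans ?_
      set z : Fin n → Bool := fun i => if i ∈ s then y i else x i
      have h1 : (fun i => if i ∈ insert a s then y i else x i) = Function.update z a (y a) := by
        funext i
        by_cases hi : i = a
        · subst hi; simp
        · simp [hi, z]
      have h2 : z = Function.update z a (x a) := by
        funext i
        by_cases hi : i = a
        · subst hi; simp [z, ha]
        · simp [hi]
      rw [h1]
      conv_lhs => rw [h2]
      have hm := h.monotone a z
      have hxy' := hxy a
      cases hx : x a <;> cases hy : y a
      · exact le_rfl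
      · exact hm
      · rw [hx, hy] at hxy'
        exact absurd (show (true : Bool) ≤ false from hxy') (by decide)
      · exact le_rfl
  simpa using key Finset.univ

lemma IsCoherent.apply_true {Φ : StructureFunction n} (h : IsCoherent Φ) (hn : 0 < n) :
    Φ (fun _ => true) = true := by
  by_contra hc
  refine h.no_irrelevant ⟨0, hn⟩ fun x => ?_
  have hle : ∀ x, Φ x = false := fun x => by
    have := h.monotone_apply (show x ≤ fun _ => true from fun i => Bool.le_true _)
    simp only [Bool.not_eq_true] at hc
    rw [hc] at this
    exact le_bot_iff.1 this
  rw [hle, hle]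

lemma IsCoherent.apply_false {Φ : StructureFunction n} (h : IsCoherent Φ) (hn : 0 < n) :
    Φ (fun _ => false) = false := by
  by_contra hc
  refine h.no_irrelevant ⟨0, hn⟩ fun x => ?_
  have hle : ∀ x, Φ x = true := fun x => by
    have := h.monotone_apply (show (fun _ => false) ≤ x from fun i => Bool.false_le _)
    simp only [Bool.not_eq_false] at hc
    rw [hc] at this
    exact top_le_iff.1 this
  rw [hle, hle]

/-- The sets of `j` components which, working alone, let the system fail. -/
def failingSets (Φ : StructureFunction n) (j : ℕ) : Finset (Finset (Fin n)) :=
  (Finset.powersetCard j Finset.univ).filter fun s => Φ (configuration s) = false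

/-- The proportion, among the configurations with exactly `j` working components, of those in
which the system works. -/
noncomputable def detWorkingProportion (Φ : StructureFunction n) (j : ℕ) : ℝ :=
  (∑ x : Fin n → Bool with (Finset.univ.filter fun i => x i = true).card = j,
    (if Φ x = true then (1 : ℝ) else 0)) / (n.choose j : ℝ)

lemma sum_configurations (F : (Fin n → Bool) → ℝ) (j : ℕ) :
    ∑ x : Fin n → Bool with (Finset.univ.filter fun i => x i = true).card = j, F x
      = ∑ s ∈ Finset.powersetCard j (Finset.univ : Finset (Fin n)), F (configuration s) := by
  refine Finset.sum_bij' (fun x _ => Finset.univ.filter fun i => x i = true)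
    (fun s _ => configuration s) ?_ ?_ ?_ ?_ ?_
  · intro x hx
    simpa [Finset.mem_powersetCard] using hx
  · intro s hs
    simpa [filter_configuration, Finset.mem_powersetCard] using hs
  · intro x _
    exact configuration_filter x
  · intro s _
    exact filter_configuration s
  · intro x _
    rw [configuration_filter]

lemma detWorkingProportion_eq (Φ : StructureFunction n) {j : ℕ} (hj : j ≤ n) :
    detWorkingProportion Φ j = 1 - ((failingSets Φ j).card : ℝ) / (n.choose j : ℝ) := by
  have hc : (n.choose j : ℝ) ≠ 0 := by exact_mod_cast (Nat.choose_pos hj).ne'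
  rw [detWorkingProportion, sum_configurations (fun x => if Φ x = true then (1 : ℝ) else 0),
    eq_sub_iff_add_eq, ← add_div, div_eq_one_iff_eq hc, failingSets, Finset.card_filter]
  push_cast
  rw [← Finset.sum_add_distrib]
  have : ∀ s ∈ Finset.powersetCard j (Finset.univ : Finset (Fin n)),
      ((if Φ (configuration s) = true then (1 : ℝ) else 0)
        + if Φ (configuration s) = false then (1 : ℝ) else 0) = 1 := by
    intro s _
    cases Φ (configuration s) <;> simp
  rw [Finset.sum_congr rfl this]
  simp

/-- Removing a component from a failing set gives a failing set, so the local
Lubell–Yamamoto–Meshalkin inequality bounds the density of failing sets in layer `j + 1` by their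
density in layer `j`. -/
lemma detWorkingProportion_le_succ {Φ : StructureFunction n} (h : IsCoherent Φ) {j : ℕ}
    (hj : j + 1 ≤ n) : detWorkingProportion Φ j ≤ detWorkingProportion Φ (j + 1) := by
  rw [detWorkingProportion_eq Φ hj, detWorkingProportion_eq Φ (by omega)]
  have hs : ((failingSets Φ (j + 1) : Finset (Finset (Fin n))) : Set (Finset (Fin n))).Sized
      (j + 1) := by
    intro s hs
    simp only [failingSets, Finset.coe_filter, Finset.mem_powersetCard, mem_ofPred_eq] at hs
    exact hs.1.2
  have h1 := Finset.local_lubell_yamamoto_meshalkin_inequality_div (𝕜 := ℝ)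
    (Nat.succ_ne_zero j) hs
  have h2 : Finset.shadow (failingSets Φ (j + 1)) ⊆ failingSets Φ j := by
    intro s hs'
    obtain ⟨t, ht, a, ha, rfl⟩ := Finset.mem_shadow_iff.1 hs'
    simp only [failingSets, Finset.mem_filter, Finset.mem_powersetCard] at ht ⊢
    refine ⟨⟨Finset.subset_univ _, by rw [Finset.card_erase_of_mem ha, ht.1.2]; simp⟩, ?_⟩
    have hle : Φ (configuration (t.erase a)) ≤ Φ (configuration t) := h.monotone_apply fun i => by
      by_cases hi : i ∈ t
      · simp [configuration, hi]
      · simp [configuration, hi]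
    rw [ht.2] at hle
    exact le_bot_iff.1 hle
  rw [Fintype.card_fin] at h1
  have h3 : ((Finset.shadow (failingSets Φ (j + 1))).card : ℝ) / (n.choose j : ℝ)
      ≤ ((failingSets Φ j).card : ℝ) / (n.choose j : ℝ) := by
    gcongr
  simp only [Nat.succ_eq_add_one, Nat.add_sub_cancel] at h1
  linarith

lemma detWorkingProportion_zero {Φ : StructureFunction n} (h : IsCoherent Φ) (hn : 0 < n) :
    detWorkingProportion Φ 0 = 0 := by
  rw [detWorkingProportion, sum_configurations (fun x => if Φ x = true then (1 : ℝ) else 0)]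
  have : configuration (∅ : Finset (Fin n)) = fun _ => false := by funext; simp [configuration]
  simp [this, h.apply_false hn]

lemma detWorkingProportion_self {Φ : StructureFunction n} (h : IsCoherent Φ) (hn : 0 < n) :
    detWorkingProportion Φ n = 1 := by
  rw [detWorkingProportion, sum_configurations (fun x => if Φ x = true then (1 : ℝ) else 0)]
  have h1 : Finset.powersetCard n (Finset.univ : Finset (Fin n)) = {Finset.univ} := by
    have := Finset.powersetCard_self (Finset.univ : Finset (Fin n))
    rwa [Finset.card_fin] at this
  have : configuration (Finset.univ : Finset (Fin n)) = fun _ => true := by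
    funext; simp [configuration]
  rw [h1, Finset.sum_singleton, this, if_pos (h.apply_true hn)]
  simp

variable {Ω : Type*} [MeasurableSpace Ω] {P : Measure Ω} {Φ : Ω → StructureFunction n}

lemma IsMixedCoherent.measurable_comp {β : Type*} [MeasurableSpace β] (h : IsMixedCoherent P Φ)
    (F : StructureFunction n → β) : Measurable fun ω => F (Φ ω) :=
  (measurable_of_countable F).comp h.measurable

variable [IsProbabilityMeasure P]

/-- A random variable that depends on the random structure function only is integrable, because it
takes finitely many values. -/
lemma IsMixedCoherent.integrable_comp (h : IsMixedCoherent P Φ) (F : StructureFunction n → ℝ) :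
    Integrable (fun ω => F (Φ ω)) P := by
  refine Integrable.of_bound (h.measurable_comp F).aestronglyMeasurable (∑ Ψ, ‖F Ψ‖)
    (Eventually.of_forall fun ω => ?_)
  exact Finset.single_le_sum (f := fun Ψ => ‖F Ψ‖) (fun _ _ => norm_nonneg _)
    (Finset.mem_univ (Φ ω))

lemma IsMixedCoherent.workingProportion_eq (h : IsMixedCoherent P Φ) (j : ℕ) :
    workingProportion P Φ j = ∫ ω, detWorkingProportion (Φ ω) j ∂P := by
  simp only [workingProportion, detWorkingProportion]
  rw [integral_div, integral_finsetSum]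
  exact fun x _ => h.integrable_comp fun Ψ => if Ψ x = true then (1 : ℝ) else 0

lemma IsMixedCoherent.workingProportion_le_succ (h : IsMixedCoherent P Φ) {j : ℕ}
    (hj : j + 1 ≤ n) : workingProportion P Φ j ≤ workingProportion P Φ (j + 1) := by
  rw [h.workingProportion_eq, h.workingProportion_eq]
  refine integral_mono_ae (h.integrable_comp fun Ψ => detWorkingProportion Ψ j)
    (h.integrable_comp fun Ψ => detWorkingProportion Ψ (j + 1)) ?_
  filter_upwards [h.coherent] with ω hω
  exact detWorkingProportion_le_succ hω hj

lemma IsMixedCoherent.workingProportion_zero (h : IsMixedCoherent P Φ) (hn : 0 < n) :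
    workingProportion P Φ 0 = 0 := by
  rw [h.workingProportion_eq]
  refine integral_eq_zero_of_ae ?_
  filter_upwards [h.coherent] with ω hω
  exact detWorkingProportion_zero hω hn

lemma IsMixedCoherent.workingProportion_self (h : IsMixedCoherent P Φ) (hn : 0 < n) :
    workingProportion P Φ n = 1 := by
  rw [h.workingProportion_eq]
  have : (fun ω => detWorkingProportion (Φ ω) n) =ᵐ[P] fun _ => 1 := by
    filter_upwards [h.coherent] with ω hω
    exact detWorkingProportion_self hω hn
  rw [integral_congr_ae this]
  simp

lemma IsMixedCoherent.signature_nonneg (h : IsMixedCoherent P Φ) {k : ℕ} (hk : 1 ≤ k)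
    (hkn : k ≤ n) : 0 ≤ signature P Φ k :=
  sub_nonneg.2 (h.workingProportion_le_succ (by omega))

end Combinatorics

/-! ### The rescaled signature as a density -/

section Density

lemma natCeil_mem_Icc {n : ℕ} {q : ℝ} (hn : 0 < n) (hq : q ∈ Ioo (0 : ℝ) 1) :
    1 ≤ ⌈(n : ℝ) * q⌉₊ ∧ ⌈(n : ℝ) * q⌉₊ ≤ n := by
  have hn' : (0 : ℝ) < n := by exact_mod_cast hn
  refine ⟨Nat.one_le_ceil_iff.2 (mul_pos hn' hq.1), Nat.ceil_le.2 ?_⟩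
  nlinarith [hq.2]

lemma measurable_natCeil_step (s : ℕ → ℝ) (n : ℕ) :
    Measurable fun q : ℝ => (n : ℝ) * s ⌈(n : ℝ) * q⌉₊ :=
  measurable_const.mul ((measurable_of_countable s).comp
    (Nat.measurable_ceil.comp (measurable_const.mul measurable_id)))

/-- The step function `q ↦ n s_⌈nq⌉` has integral `s_k` over `((k-1)/n, k/n]`; summing from the
top gives the integral over `(1 - j/n, 1]` as a telescoping sum of increments of `φ`. -/
lemma integral_natCeil_step (φ s : ℕ → ℝ) {n : ℕ} (hn : 0 < n)
    (hs : ∀ k, s k = φ (n - k + 1) - φ (n - k)) {j : ℕ} (hj : j ≤ n) :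
    IntervalIntegrable (fun q : ℝ => (n : ℝ) * s ⌈(n : ℝ) * q⌉₊) volume (1 - (j : ℝ) / n) 1 ∧
    ∫ q in (1 - (j : ℝ) / n)..1, (n : ℝ) * s ⌈(n : ℝ) * q⌉₊ = φ j - φ 0 := by
  have hn' : (0 : ℝ) < n := by exact_mod_cast hn
  induction j with
  | zero => simp
  | succ j ih =>
    obtain ⟨ih1, ih2⟩ := ih (by omega)
    set a : ℝ := 1 - ((j + 1 : ℕ) : ℝ) / n with ha
    set b : ℝ := 1 - (j : ℝ) / n with hb
    have hab : b - a = 1 / n := by rw [ha, hb]; push_cast; ring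
    have hle : a ≤ b := by
      have : (0 : ℝ) < 1 / n := by positivity
      linarith
    have hconst : ∀ q ∈ Ioc a b, (n : ℝ) * s (n - j) = (n : ℝ) * s ⌈(n : ℝ) * q⌉₊ := by
      intro q hq
      congr 2
      symm
      rw [Nat.ceil_eq_iff (by omega)]
      have h1 : (n : ℝ) * a = n - (j + 1) := by rw [ha]; push_cast; field_simp
      have h2 : (n : ℝ) * b = n - j := by rw [hb]; field_simp
      have h3 := mul_lt_mul_of_pos_left hq.1 hn'
      have h4 := mul_le_mul_of_nonneg_left hq.2 hn'.le
      rw [Nat.cast_sub (by omega), Nat.cast_sub (by omega)]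
      push_cast
      constructor <;> linarith
    have hint : IntervalIntegrable (fun q : ℝ => (n : ℝ) * s ⌈(n : ℝ) * q⌉₊) volume a b := by
      refine (intervalIntegrable_const (c := (n : ℝ) * s (n - j))).congr ?_
      rw [uIoc_of_le hle]
      exact hconst
    have hval : ∫ q in a..b, (n : ℝ) * s ⌈(n : ℝ) * q⌉₊ = s (n - j) := by
      rw [intervalIntegral.integral_congr_ae (g := fun _ => (n : ℝ) * s (n - j))]
      · rw [intervalIntegral.integral_const, hab]
        simp only [smul_eq_mul]
        field_simp
      · rw [uIoc_of_le hle]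
        exact Eventually.of_forall fun q hq => (hconst q hq).symm
    refine ⟨hint.trans ih1, ?_⟩
    rw [← intervalIntegral.integral_add_adjacent_intervals hint ih1, hval, ih2, hs,
      Nat.sub_sub_self (by omega)]
    ring

/-- The tail function `x ↦ ∫_{1-x}^1 f`, as a continuous function on the unit interval. -/
noncomputable def tailFunction (f : ℝ → ℝ) (hf : Integrable f) : C(unitInterval, ℝ) where
  toFun x := ∫ q in (1 - (x : ℝ))..1, f q
  continuous_toFun := by
    have h := intervalIntegral.continuous_primitive (μ := volume) (f := f)
      (fun a b => hf.intervalIntegrable) 1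
    have h2 : Continuous fun x : unitInterval => -∫ q in (1 : ℝ)..(1 - (x : ℝ)), f q :=
      (h.comp (continuous_const.sub continuous_subtype_val)).neg
    simpa only [← intervalIntegral.integral_symm] using h2

end Density

/-! ### Convergence of the rescaled signatures and of the Bernstein polynomials -/

section Limits

variable {φ s : ℕ+ → ℕ → ℝ} {f g : ℝ → ℝ}

/-- Data abstracting the signatures of a sequence of coherent systems that satisfies the
convergence and domination assumptions: `φ n` is the sequence of working proportions of the `n`-th
system and `s n` its signature. -/
structure DominatedSignatures (φ s : ℕ+ → ℕ → ℝ) (f g : ℝ → ℝ) : Prop where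
  sub_eq : ∀ (n : ℕ+) k, s n k = φ n (n - k + 1) - φ n (n - k)
  zero : ∀ n, φ n 0 = 0
  self : ∀ n : ℕ+, φ n n = 1
  nonneg : ∀ (n : ℕ+) (k : ℕ), 1 ≤ k → k ≤ n → 0 ≤ s n k
  measurable : Measurable f
  support : ∀ q, q ∉ Ioo (0 : ℝ) 1 → f q = 0
  tendsto : ∀ q ∈ Ioo (0 : ℝ) 1,
    Tendsto (fun n : ℕ+ => (n : ℝ) * s n ⌈(n : ℝ) * q⌉₊) atTop (𝓝 (f q))
  integrableOn : IntegrableOn g (Ioo 0 1)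
  le : ∀ q ∈ Ioo (0 : ℝ) 1, ∀ n : ℕ+, (n : ℝ) * s n ⌈(n : ℝ) * q⌉₊ ≤ g q

namespace DominatedSignatures

lemma step_nonneg (h : DominatedSignatures φ s f g) {q : ℝ} (hq : q ∈ Ioo (0 : ℝ) 1) (n : ℕ+) :
    0 ≤ (n : ℝ) * s n ⌈(n : ℝ) * q⌉₊ :=
  have hc := natCeil_mem_Icc n.pos hq
  mul_nonneg (Nat.cast_nonneg _) (h.nonneg n _ hc.1 hc.2)

lemma density_nonneg (h : DominatedSignatures φ s f g) (q : ℝ) : 0 ≤ f q := by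
  by_cases hq : q ∈ Ioo (0 : ℝ) 1
  · exact ge_of_tendsto' (h.tendsto q hq) fun n => h.step_nonneg hq n
  · exact (h.support q hq).ge

lemma density_le (h : DominatedSignatures φ s f g) {q : ℝ} (hq : q ∈ Ioo (0 : ℝ) 1) :
    f q ≤ g q :=
  le_of_tendsto' (h.tendsto q hq) fun n => h.le q hq n

lemma norm_step_sub_le (h : DominatedSignatures φ s f g) {q : ℝ} (hq : q ∈ Ioo (0 : ℝ) 1)
    (n : ℕ+) : ‖(n : ℝ) * s n ⌈(n : ℝ) * q⌉₊ - f q‖ ≤ g q := by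
  have h1 := h.step_nonneg hq n
  have h2 := h.le q hq n
  have h3 := h.density_nonneg q
  have h4 := h.density_le hq
  rw [Real.norm_eq_abs, abs_le]
  constructor <;> linarith

lemma integrable_density (h : DominatedSignatures φ s f g) : Integrable f := by
  have h1 : IntegrableOn f (Ioo 0 1) := by
    refine h.integrableOn.mono' h.measurable.aestronglyMeasurable ?_
    filter_upwards [ae_restrict_mem measurableSet_Ioo] with q hq
    rw [Real.norm_of_nonneg (h.density_nonneg q)]
    exact h.density_le hq
  exact (integrableOn_iff_integrable_of_support_subset fun q hq => by
    by_contra hc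
    exact hq (h.support q hc)).1 h1

lemma measurable_step_sub (h : DominatedSignatures φ s f g) (n : ℕ+) :
    Measurable fun q : ℝ => (n : ℝ) * s n ⌈(n : ℝ) * q⌉₊ - f q :=
  (measurable_natCeil_step (s n) n).sub h.measurable

lemma integrableOn_step_sub (h : DominatedSignatures φ s f g) (n : ℕ+) :
    IntegrableOn (fun q : ℝ => (n : ℝ) * s n ⌈(n : ℝ) * q⌉₊ - f q) (Ioo 0 1) := by
  refine h.integrableOn.mono' (h.measurable_step_sub n).aestronglyMeasurable ?_
  filter_upwards [ae_restrict_mem measurableSet_Ioo] with q hq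
  exact h.norm_step_sub_le hq n

lemma tendsto_integral_norm (h : DominatedSignatures φ s f g) :
    Tendsto (fun n : ℕ+ => ∫ q in Ioo (0 : ℝ) 1, ‖(n : ℝ) * s n ⌈(n : ℝ) * q⌉₊ - f q‖) atTop
      (𝓝 0) := by
  suffices Tendsto (fun n : ℕ+ => ∫ q in Ioo (0 : ℝ) 1, ‖(n : ℝ) * s n ⌈(n : ℝ) * q⌉₊ - f q‖) atTop
      (𝓝 (∫ q in Ioo (0 : ℝ) 1, (0 : ℝ))) by simpa only [integral_zero] using this
  refine tendsto_integral_filter_of_dominated_convergence (l := atTop)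
    (F := fun (n : ℕ+) q => ‖(n : ℝ) * s n ⌈(n : ℝ) * q⌉₊ - f q‖) g ?_ ?_ h.integrableOn ?_
  · exact Eventually.of_forall fun n => (h.measurable_step_sub n).norm.aestronglyMeasurable
  · refine Eventually.of_forall fun n => ?_
    filter_upwards [ae_restrict_mem measurableSet_Ioo] with q hq
    rw [norm_norm]
    exact h.norm_step_sub_le hq n
  · filter_upwards [ae_restrict_mem measurableSet_Ioo] with q hq
    have := ((h.tendsto q hq).sub_const (f q)).norm
    simpa using this

lemma abs_sub_tail_le (h : DominatedSignatures φ s f g) (n : ℕ+) {j : ℕ} (hj : j ≤ n) :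
    |φ n j - ∫ q in (1 - (j : ℝ) / n)..1, f q|
      ≤ ∫ q in Ioo (0 : ℝ) 1, ‖(n : ℝ) * s n ⌈(n : ℝ) * q⌉₊ - f q‖ := by
  obtain ⟨h1, h2⟩ := integral_natCeil_step (φ n) (s n) n.pos (h.sub_eq n) hj
  have hn : (0 : ℝ) < (n : ℕ) := by exact_mod_cast n.pos
  have hle : 1 - (j : ℝ) / (n : ℕ) ≤ 1 := by
    have : 0 ≤ (j : ℝ) / (n : ℕ) := by positivity
    linarith
  have hge : 0 ≤ 1 - (j : ℝ) / (n : ℕ) := by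
    have : (j : ℝ) / (n : ℕ) ≤ 1 := div_le_one_of_le₀ (by exact_mod_cast hj) hn.le
    linarith
  rw [h.zero, sub_zero] at h2
  rw [← h2, ← intervalIntegral.integral_sub h1 h.integrable_density.intervalIntegrable,
    intervalIntegral.integral_of_le hle, integral_Ioc_eq_integral_Ioo, ← Real.norm_eq_abs]
  refine (norm_integral_le_integral_norm _).trans ?_
  exact setIntegral_mono_set (h.integrableOn_step_sub n).norm
    (Eventually.of_forall fun _ => norm_nonneg _) (Ioo_subset_Ioo_left hge).eventuallyLE

lemma integral_density (h : DominatedSignatures φ s f g) : ∫ q, f q = 1 := by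
  have h1 : ∫ q, f q = ∫ q in (0 : ℝ)..1, f q := by
    rw [intervalIntegral.integral_of_le zero_le_one, integral_Ioc_eq_integral_Ioo,
      setIntegral_eq_integral_of_forall_compl_eq_zero h.support]
  have h2 : |1 - ∫ q in (0 : ℝ)..1, f q| ≤ 0 := by
    refine ge_of_tendsto' h.tendsto_integral_norm fun n => ?_
    have h3 := h.abs_sub_tail_le n le_rfl
    have hn : ((n : ℕ) : ℝ) ≠ 0 := by exact_mod_cast n.pos.ne'
    rwa [h.self, div_self hn, sub_self] at h3
  rw [h1]
  linarith [abs_nonpos_iff.1 h2]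

end DominatedSignatures

lemma tendsto_pnat_coe_atTop : Tendsto (fun n : ℕ+ => (n : ℕ)) atTop atTop :=
  tendsto_atTop_atTop.2 fun b => ⟨b.succPNat, fun a ha => by
    have : (b.succPNat : ℕ) ≤ a := ha
    rw [Nat.succPNat_coe] at this
    omega⟩

lemma abs_sum_bernstein_sub_le (G : C(unitInterval, ℝ)) (n : ℕ) (a : ℕ → ℝ) {ε : ℝ}
    (ha : ∀ k : Fin (n + 1), |a k - G (bernstein.z k)| ≤ ε) (x : unitInterval) :
    |∑ k : Fin (n + 1), bernstein n k x * a k - G x|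
      ≤ ε + ‖bernsteinApproximation n G - G‖ := by
  have h1 : |∑ k : Fin (n + 1), bernstein n k x * a k - bernsteinApproximation n G x| ≤ ε := by
    rw [bernsteinApproximation.apply, ← Finset.sum_sub_distrib]
    calc |∑ k : Fin (n + 1), (bernstein n k x * a k - bernstein n k x • G (bernstein.z k))|
        ≤ ∑ k : Fin (n + 1), |bernstein n k x * a k - bernstein n k x • G (bernstein.z k)| :=
          Finset.abs_sum_le_sum_abs _ _
      _ ≤ ∑ k : Fin (n + 1), bernstein n k x * ε := by
          refine Finset.sum_le_sum fun k _ => ?_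
          rw [smul_eq_mul, ← mul_sub, abs_mul, abs_of_nonneg bernstein_nonneg]
          exact mul_le_mul_of_nonneg_left (ha k) bernstein_nonneg
      _ = ε := by rw [← Finset.sum_mul, bernstein.probability, one_mul]
  have h2 : |bernsteinApproximation n G x - G x| ≤ ‖bernsteinApproximation n G - G‖ := by
    simpa using (bernsteinApproximation n G - G).norm_coe_le_norm x
  calc _ ≤ _ := abs_sub_le _ (bernsteinApproximation n G x) _
    _ ≤ _ := add_le_add h1 h2

/-- The working proportions `φ n k` are uniformly close to the values at `k / n` of the tail
function of the limit density. Hence their Bernstein polynomials converge to the tail function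
uniformly on the unit interval, and so do the expectations of these polynomials at a random
point. -/
lemma DominatedSignatures.tendsto_integral_bernstein (h : DominatedSignatures φ s f g)
    {Ω : Type*} [MeasurableSpace Ω] (P : Measure Ω) [IsProbabilityMeasure P]
    {p : Ω → unitInterval} (hp : Measurable p) :
    Tendsto (fun n : ℕ+ => ∫ ω, ∑ k : Fin ((n : ℕ) + 1), bernstein n k (p ω) * φ n k ∂P) atTop
      (𝓝 (∫ ω, tailFunction f h.integrable_density (p ω) ∂P)) := by
  set G := tailFunction f h.integrable_density
  set err : ℕ+ → ℝ := fun n => (∫ q in Ioo (0 : ℝ) 1, ‖(n : ℝ) * s n ⌈(n : ℝ) * q⌉₊ - f q‖)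
    + ‖bernsteinApproximation n G - G‖
  have hB : Tendsto (fun n : ℕ+ => ‖bernsteinApproximation n G - G‖) atTop (𝓝 0) :=
    tendsto_iff_norm_sub_tendsto_zero.1
      ((bernsteinApproximation_uniform G).comp tendsto_pnat_coe_atTop)
  have herr0 : Tendsto err atTop (𝓝 0) := by
    simpa only [add_zero] using h.tendsto_integral_norm.add hB
  have hint : ∀ F : C(unitInterval, ℝ), Integrable (fun ω => F (p ω)) P := fun F =>
    Integrable.of_bound (F.continuous.measurable.comp hp).aestronglyMeasurable ‖F‖
      (Eventually.of_forall fun ω => F.norm_coe_le_norm _)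
  refine tendsto_iff_norm_sub_tendsto_zero.2
    (squeeze_zero (fun _ => norm_nonneg _) (fun n => ?_) herr0)
  have hsum : Integrable (fun ω => ∑ k : Fin ((n : ℕ) + 1), bernstein n k (p ω) * φ n k) P :=
    integrable_finsetSum _ fun k _ => (hint (bernstein n k)).mul_const _
  rw [← integral_sub hsum (hint G)]
  refine (norm_integral_le_of_norm_le_const (C := err n) (Eventually.of_forall fun ω => ?_)).trans
    (by simp)
  exact abs_sum_bernstein_sub_le G n (φ n) (fun k => h.abs_sub_tail_le n k.is_le) (p ω)

end Limits

/-! ### Convergence in distribution on `[0, ∞]` -/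

section Distribution

/-- The intervals `[0, b]` and `(a, b]` of `[0, ∞]` with `0 < a` and `0 < b`. -/
def rightClosedIntervals : Set (Set ℝ≥0∞) :=
  {s | ∃ b, 0 < b ∧ (s = Iic b ∨ ∃ a, 0 < a ∧ s = Ioi a ∩ Iic b)}

lemma isPiSystem_rightClosedIntervals : IsPiSystem rightClosedIntervals := by
  rintro s ⟨b, hb, hs⟩ t ⟨b', hb', ht⟩ -
  refine ⟨min b b', lt_min hb hb', ?_⟩
  rcases hs with rfl | ⟨a, ha, rfl⟩ <;> rcases ht with rfl | ⟨a', ha', rfl⟩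
  · left
    exact Iic_inter_Iic
  · right
    refine ⟨a', ha', ?_⟩
    rw [← Iic_inter_Iic]
    ext x; simp only [mem_inter_iff]; tauto
  · right
    refine ⟨a, ha, ?_⟩
    rw [← Iic_inter_Iic]
    ext x; simp only [mem_inter_iff]; tauto
  · right
    refine ⟨max a a', lt_max_of_lt_left ha, ?_⟩
    rw [← Iic_inter_Iic, ← Ioi_inter_Ioi]
    ext x; simp only [mem_inter_iff]; tauto

lemma exists_rightClosedInterval_mem_nhds {u : Set ℝ≥0∞} (hu : IsOpen u) {x : ℝ≥0∞} (hx : x ∈ u) :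
    ∃ s ∈ rightClosedIntervals, s ∈ 𝓝 x ∧ s ⊆ u := by
  have hux := hu.mem_nhds hx
  obtain ⟨b, hb, hbx, hbu⟩ : ∃ b, 0 < b ∧ Iic b ∈ 𝓝 x ∧ Icc x b ⊆ u := by
    rcases eq_or_ne x ⊤ with rfl | hx'
    · refine ⟨⊤, by simp, by simp, fun y hy => ?_⟩
      rwa [top_le_iff.1 hy.1]
    · obtain ⟨r, hr, hru⟩ := exists_Ico_subset_of_mem_nhds hux ⟨⊤, lt_top_iff_ne_top.2 hx'⟩
      obtain ⟨b, hxb, hbr⟩ := exists_between hr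
      exact ⟨b, zero_le.trans_lt hxb, Iic_mem_nhds hxb,
        fun y hy => hru ⟨hy.1, hy.2.trans_lt hbr⟩⟩
  rcases eq_or_ne x 0 with rfl | hx0
  · exact ⟨Iic b, ⟨b, hb, Or.inl rfl⟩, hbx, fun y hy => hbu ⟨zero_le, hy⟩⟩
  · obtain ⟨l, hl, hlu⟩ := exists_Ioc_subset_of_mem_nhds hux ⟨0, pos_iff_ne_zero.2 hx0⟩
    obtain ⟨a, hla, hax⟩ := exists_between hl
    refine ⟨Ioi a ∩ Iic b, ⟨b, hb, Or.inr ⟨a, zero_le.trans_lt hla, rfl⟩⟩,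
      inter_mem (Ioi_mem_nhds hax) hbx, fun y hy => ?_⟩
    rcases le_total y x with hyx | hyx
    · exact hlu ⟨hla.trans hy.1, hyx⟩
    · exact hbu ⟨hyx, hy.2⟩

/-- Convergence of the tail probabilities at all positive times is convergence in distribution
on `[0, ∞]`; no continuity of the limit law is used. -/
lemma tendstoInDistribution_of_tendsto_tail {ι : Type*} {l : Filter ι} [l.IsCountablyGenerated]
    {Ωs : ι → Type*} [∀ i, MeasurableSpace (Ωs i)] {Ps : ∀ i, Measure (Ωs i)}
    [∀ i, IsProbabilityMeasure (Ps i)] {Ω' : Type*} [MeasurableSpace Ω'] {P' : Measure Ω'}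
    [IsProbabilityMeasure P'] {X : ∀ i, Ωs i → ℝ≥0∞} {Z : Ω' → ℝ≥0∞}
    (hX : ∀ i, AEMeasurable (X i) (Ps i)) (hZ : AEMeasurable Z P')
    (h : ∀ t : ℝ≥0, 0 < t →
      Tendsto (fun i => Ps i {ω | (t : ℝ≥0∞) < X i ω}) l (𝓝 (P' {ω | (t : ℝ≥0∞) < Z ω}))) :
    TendstoInDistribution X l Z Ps P' := by
  refine ⟨hX, hZ, ?_⟩
  set μ : ι → ProbabilityMeasure ℝ≥0∞ :=
    fun i => ⟨(Ps i).map (X i), Measure.isProbabilityMeasure_map (hX i)⟩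
  set ν : ProbabilityMeasure ℝ≥0∞ := ⟨P'.map Z, Measure.isProbabilityMeasure_map hZ⟩
  have htail : ∀ c : ℝ≥0∞, 0 < c →
      Tendsto (fun i => (μ i : Measure ℝ≥0∞).real (Ioi c)) l
        (𝓝 ((ν : Measure ℝ≥0∞).real (Ioi c))) := by
    intro c hc
    induction c with
    | top => simpa using tendsto_const_nhds
    | coe t =>
      have h1 := h t (by exact_mod_cast hc)
      have h2 := (ENNReal.tendsto_toReal (measure_ne_top P' {ω | (t : ℝ≥0∞) < Z ω})).comp h1
      have e1 : ∀ i, (μ i : Measure ℝ≥0∞).real (Ioi (t : ℝ≥0∞))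
          = (Ps i {ω | (t : ℝ≥0∞) < X i ω}).toReal := fun i => by
        rw [measureReal_def]
        congr 1
        exact Measure.map_apply_of_aemeasurable (hX i) measurableSet_Ioi
      have e2 : (ν : Measure ℝ≥0∞).real (Ioi (t : ℝ≥0∞))
          = (P' {ω | (t : ℝ≥0∞) < Z ω}).toReal := by
        rw [measureReal_def]
        congr 1
        exact Measure.map_apply_of_aemeasurable hZ measurableSet_Ioi
      simp only [e1, e2]
      exact h2
  have hIic : ∀ (m : ProbabilityMeasure ℝ≥0∞) (c : ℝ≥0∞),
      (m : Measure ℝ≥0∞).real (Iic c) = 1 - (m : Measure ℝ≥0∞).real (Ioi c) := fun m c => by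
    rw [← compl_Ioi, probReal_compl_eq_one_sub measurableSet_Ioi]
  have hIoc : ∀ (m : ProbabilityMeasure ℝ≥0∞) {a b : ℝ≥0∞}, a ≤ b →
      (m : Measure ℝ≥0∞).real (Ioi a ∩ Iic b)
        = (m : Measure ℝ≥0∞).real (Ioi a) - (m : Measure ℝ≥0∞).real (Ioi b) := fun m a b hab => by
    have : Ioi a ∩ Iic b = Ioi a \ Ioi b := by
      ext x; simp
    rw [this, measureReal_sdiff (Ioi_subset_Ioi hab) measurableSet_Ioi]
  refine isPiSystem_rightClosedIntervals.tendsto_probabilityMeasure_of_tendsto_of_mem ?_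
    (fun u hu x hx => exists_rightClosedInterval_mem_nhds hu hx) ?_
  · rintro s ⟨b, -, rfl | ⟨a, -, rfl⟩⟩
    · exact measurableSet_Iic
    · exact measurableSet_Ioi.inter measurableSet_Iic
  · intro s hs
    rw [← NNReal.tendsto_coe]
    change Tendsto (fun i => (μ i : Measure ℝ≥0∞).real s) l (𝓝 ((ν : Measure ℝ≥0∞).real s))
    obtain ⟨b, hb, rfl | ⟨a, ha, rfl⟩⟩ := hs
    · simp only [hIic]
      exact (htail b hb).const_sub 1
    · rcases le_total a b with hab | hab
      · simp only [hIoc _ hab]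
        exact (htail a ha).sub (htail b hb)
      · have : Ioi a ∩ Iic b = ∅ := by
          ext x
          simp only [mem_inter_iff, mem_Ioi, mem_Iic, mem_empty_iff_false, iff_false, not_and,
            not_le]
          exact fun hx => hab.trans_lt hx
        simpa [this] using tendsto_const_nhds

end Distribution

/-! ### Failure times along a fixed path -/

section Paths

/-- The configuration of the components still working at time `t` is right-continuous in `t`, so
a monotone system that works at time `t` works on some interval `[t, s)` as well. -/
lemma lt_systemFailureTime_iff {n : ℕ} {Φ : StructureFunction n} (hΦ : Monotone Φ)
    (T : Fin n → ℝ≥0∞) (t : ℝ≥0) :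
    (t : ℝ≥0∞) < systemFailureTime Φ T ↔ Φ (fun i => decide ((t : ℝ≥0∞) < T i)) = true := by
  constructor
  · intro h
    by_contra hc
    rw [Bool.not_eq_true] at hc
    exact absurd h (not_lt.2 (iInf₂_le t hc))
  · intro h
    have hev : ∀ᶠ s : ℝ≥0 in 𝓝[>] t, ∀ i, (t : ℝ≥0∞) < T i → (s : ℝ≥0∞) < T i := by
      refine eventually_all.2 fun i => ?_
      by_cases hi : (t : ℝ≥0∞) < T i
      · filter_upwards [((ENNReal.continuous_coe.tendsto t).eventually_lt_const hi).filter_mono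
          nhdsWithin_le_nhds] with s hs _
        exact hs
      · exact Eventually.of_forall fun s hs => absurd hs hi
    obtain ⟨s, hs, hts⟩ := (hev.and self_mem_nhdsWithin).exists
    have hts' : (t : ℝ≥0∞) < s := by exact_mod_cast hts
    refine hts'.trans_le (le_iInf₂ fun r hr => ?_)
    by_contra hrs
    rw [not_le] at hrs
    have hle : (fun i => decide ((t : ℝ≥0∞) < T i)) ≤ fun i => decide ((r : ℝ≥0∞) < T i) := by
      intro i
      by_cases hi : (t : ℝ≥0∞) < T i
      · simp [hi, hrs.trans (hs i hi)]
      · simp [hi]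
    have := hΦ hle
    rw [h, hr] at this
    exact absurd this (by decide)

lemma componentFailureTime_le_of_lt {ℓ : ℝ≥0 → ℝ} {ε : ℝ} {t : ℝ≥0} (h : ε < ℓ t) :
    componentFailureTime ℓ ε ≤ t :=
  iInf₂_le t h

lemma lt_componentFailureTime_of_lt {ℓ : ℝ≥0 → ℝ} (hm : Monotone ℓ) {ε : ℝ} {t : ℝ≥0}
    (hc : ContinuousWithinAt ℓ (Ici t) t) (h : ℓ t < ε) :
    (t : ℝ≥0∞) < componentFailureTime ℓ ε := by
  have hc' : ContinuousWithinAt ℓ (Ioi t) t := hc.mono Ioi_subset_Ici_self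
  obtain ⟨s, hs, hts⟩ := ((hc'.eventually_lt_const h).and self_mem_nhdsWithin).exists
  have hts' : (t : ℝ≥0∞) < s := by exact_mod_cast hts
  refine hts'.trans_le (le_iInf₂ fun r hr => ?_)
  by_contra hrs
  rw [not_le, ENNReal.coe_lt_coe] at hrs
  exact absurd (hm hrs.le) (not_le.2 (hs.trans hr))

/-- Away from the null event `ℓ t = ε`, a component is working at time `t` iff the path has not
yet reached its trigger. -/
lemma lt_componentFailureTime_iff {ℓ : ℝ≥0 → ℝ} (hm : Monotone ℓ) {ε : ℝ} {t : ℝ≥0}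
    (hc : ContinuousWithinAt ℓ (Ici t) t) (h : ε ≠ ℓ t) :
    (t : ℝ≥0∞) < componentFailureTime ℓ ε ↔ ℓ t < ε := by
  refine ⟨fun ht => ?_, lt_componentFailureTime_of_lt hm hc⟩
  by_contra hlt
  exact absurd ht (not_lt.2 (componentFailureTime_le_of_lt (lt_of_le_of_ne (not_lt.1 hlt) h)))

lemma lt_firstPassageTime_iff {ℓ : ℝ≥0 → ℝ} (hm : Monotone ℓ) {b : ℝ} {t : ℝ≥0} (ht : 0 < t)
    (hc : ContinuousWithinAt ℓ (Ici t) t) (h : b ≠ ℓ t) :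
    (t : ℝ≥0∞) < firstPassageTime ℓ b ↔ ℓ t < b := by
  constructor
  · intro hlt
    by_contra hle
    exact absurd hlt (not_lt.2 (iInf₂_le t ⟨ht, lt_of_le_of_ne (not_lt.1 hle) h⟩))
  · intro hlt
    exact (lt_componentFailureTime_of_lt hm hc hlt).trans_le
      (le_iInf₂ fun r hr => iInf₂_le r hr.2)

/-- Along a monotone path, the infimum defining the first passage time may be taken over
rational times, which makes it a measurable function of the path. -/
lemma firstPassageTime_eq_iInf_rat {ℓ : ℝ≥0 → ℝ} (hm : Monotone ℓ) (b : ℝ) :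
    firstPassageTime ℓ b
      = ⨅ r : ℚ, if 0 < Real.toNNReal r ∧ b < ℓ (Real.toNNReal r)
          then (Real.toNNReal r : ℝ≥0∞) else ⊤ := by
  refine le_antisymm (le_iInf fun r => ?_) (le_iInf₂ fun t ht => ?_)
  · split_ifs with h
    · exact iInf₂_le (Real.toNNReal r) h
    · exact le_top
  · refine le_of_forall_gt fun c hc => ?_
    obtain ⟨r, -, hr1, hr2⟩ := ENNReal.lt_iff_exists_rat_btwn.1 hc
    have hr : t < Real.toNNReal r := by exact_mod_cast hr1
    refine (iInf_le _ r).trans_lt ?_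
    rwa [if_pos ⟨ht.1.trans hr, ht.2.trans_le (hm hr.le)⟩]

end Paths

/-! ### Survival probabilities of the components -/

section Exponential

instance : IsProbabilityMeasure (expMeasure 1) := isProbabilityMeasure_expMeasure one_pos

instance : NullSingletonClass (expMeasure 1) :=
  nullSingletonClass_withDensity (μ := volume) (gammaPDF 1 1)

lemma expMeasure_real_Iic {x : ℝ} (hx : 0 ≤ x) :
    (expMeasure 1).real (Iic x) = 1 - Real.exp (-x) := by
  rw [← cdf_eq_real, cdf_expMeasure_eq one_pos, if_pos hx, one_mul]

lemma expMeasure_real_Ioi {x : ℝ} (hx : 0 ≤ x) :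
    (expMeasure 1).real (Ioi x) = Real.exp (-x) := by
  rw [← compl_Iic, probReal_compl_eq_one_sub measurableSet_Iic, expMeasure_real_Iic hx]
  ring

variable {Ω : Type*} [MeasurableSpace Ω] {P : Measure Ω} {L : ℝ≥0 → Ω → ℝ}

/-- `exp (-L_t)`, the conditional probability given `L` that a component still works at time `t`.
The positive part, which changes nothing almost surely, places it in the unit interval
everywhere. -/
noncomputable def survivalProbability (L : ℝ≥0 → Ω → ℝ) (t : ℝ≥0) (ω : Ω) : unitInterval :=
  ⟨Real.exp (-max (L t ω) 0), (Real.exp_pos _).le, Real.exp_le_one_iff.2 (by simp)⟩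

namespace IsLevySubordinator

lemma measurable_survivalProbability (hL : IsLevySubordinator P L) (t : ℝ≥0) :
    Measurable (survivalProbability L t) :=
  (Real.measurable_exp.comp ((hL.measurable t).max measurable_const).neg).subtype_mk

lemma ae_nonneg (hL : IsLevySubordinator P L) (t : ℝ≥0) : ∀ᵐ ω ∂P, 0 ≤ L t ω := by
  filter_upwards [hL.start_zero, hL.monotone_paths] with ω h0 hm
  rw [← h0]
  exact hm (zero_le : 0 ≤ t)

lemma ae_coe_survivalProbability (hL : IsLevySubordinator P L) (t : ℝ≥0) :
    ∀ᵐ ω ∂P, (survivalProbability L t ω : ℝ) = Real.exp (-L t ω) := by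
  filter_upwards [hL.ae_nonneg t] with ω h
  simp [survivalProbability, max_eq_left h]

/-- An exponential trigger independent of `L` has no atoms, so almost surely no trigger equals
`L_t`. -/
lemma ae_forall_ne (hL : IsLevySubordinator P L) (t : ℝ≥0) (n : ℕ) :
    ∀ᵐ z ∂(P.prod (Measure.pi fun _ : Fin n => expMeasure 1)), ∀ i, z.2 i ≠ L t z.1 := by
  refine ae_all_iff.2 fun i => ?_
  have hms : MeasurableSet {z : Ω × (Fin n → ℝ) | z.2 i = L t z.1} :=
    measurableSet_eq_fun ((measurable_pi_apply i).comp measurable_snd)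
      ((hL.measurable t).comp measurable_fst)
  rw [ae_iff]
  simp only [ne_eq, not_not]
  rw [Measure.measure_prod_null hms]
  exact Eventually.of_forall fun ω =>
    Measure.pi_hyperplane (fun _ : Fin n => expMeasure 1) i (L t ω)

variable [IsProbabilityMeasure P]

/-- Given `L`, the components are working independently at time `t` with probability
`exp (-L_t)`. -/
lemma integral_configuration (hL : IsLevySubordinator P L) (t : ℝ≥0) {n : ℕ}
    (x : Fin n → Bool) :
    ∫ z, (if (fun i => decide ((t : ℝ≥0∞) < componentFailureTime (fun s => L s z.1) (z.2 i))) = x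
        then (1 : ℝ) else 0) ∂(P.prod (Measure.pi fun _ : Fin n => expMeasure 1))
      = ∫ ω, ∏ i, (if x i = true then (survivalProbability L t ω : ℝ)
        else 1 - survivalProbability L t ω) ∂P := by
  set w : Bool → Ω → ℝ → ℝ := fun b ω ε => if decide (L t ω < ε) = b then 1 else 0 with hw
  have hwm : ∀ b, Measurable fun z : Ω × ℝ => w b z.1 z.2 := fun b => by
    have hms : MeasurableSet {z : Ω × ℝ | L t z.1 < z.2} :=
      measurableSet_lt ((hL.measurable t).comp measurable_fst) measurable_snd
    cases b
    · simp only [hw, decide_eq_false_iff_not]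
      exact Measurable.ite hms.compl measurable_const measurable_const
    · simp only [hw, decide_eq_true_eq]
      exact Measurable.ite hms measurable_const measurable_const
  have h1 : (fun z : Ω × (Fin n → ℝ) =>
      if (fun i => decide ((t : ℝ≥0∞) < componentFailureTime (fun s => L s z.1) (z.2 i))) = x
        then (1 : ℝ) else 0)
      =ᵐ[P.prod (Measure.pi fun _ : Fin n => expMeasure 1)]
      fun z => ∏ i, w (x i) z.1 (z.2 i) := by
    filter_upwards [hL.ae_forall_ne t n, Measure.quasiMeasurePreserving_fst.ae hL.monotone_paths,
      Measure.quasiMeasurePreserving_fst.ae hL.right_continuous] with z hz hm hc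
    have : ∀ i, ((t : ℝ≥0∞) < componentFailureTime (fun s => L s z.1) (z.2 i)) ↔ L t z.1 < z.2 i :=
      fun i => lt_componentFailureTime_iff hm (hc t) (hz i)
    simp only [this, hw, Finset.prod_ite_zero, Finset.prod_const_one, Finset.mem_univ,
      forall_const, funext_iff]
  rw [integral_congr_ae h1, integral_prod]
  · refine integral_congr_ae ?_
    filter_upwards [hL.ae_nonneg t, hL.ae_coe_survivalProbability t] with ω h0 hp
    rw [integral_fintype_prod_eq_prod (f := fun i ε => w (x i) ω ε)]
    refine Finset.prod_congr rfl fun i _ => ?_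
    cases x i
    · have : (fun ε => w false ω ε) = (Iic (L t ω)).indicator 1 := by
        funext ε
        simp [hw, indicator]
      rw [this, integral_indicator_one measurableSet_Iic, expMeasure_real_Iic h0, hp]
      simp
    · have : (fun ε => w true ω ε) = (Ioi (L t ω)).indicator 1 := by
        funext ε
        simp [hw, indicator]
      rw [this, integral_indicator_one measurableSet_Ioi, expMeasure_real_Ioi h0, hp]
      simp
  · refine Integrable.of_bound (C := 1) (Finset.measurable_fun_prod _ fun i _ =>
      (hwm (x i)).comp (measurable_fst.prodMk ((measurable_pi_apply i).comp measurable_snd))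
      ).aestronglyMeasurable (Eventually.of_forall fun z => ?_)
    rw [norm_prod]
    refine Finset.prod_le_one (fun _ _ => norm_nonneg _) fun i _ => ?_
    simp only [hw]
    split_ifs <;> simp

end IsLevySubordinator

end Exponential

/-! ### Survival probability of the system -/

section System

variable {n : ℕ}

lemma measurable_workingConfiguration (t : ℝ≥0) :
    Measurable fun (T : Fin n → ℝ≥0∞) (i : Fin n) => decide ((t : ℝ≥0∞) < T i) := by
  refine measurable_pi_lambda _ fun i => measurable_to_bool ?_
  have : (fun T : Fin n → ℝ≥0∞ => decide ((t : ℝ≥0∞) < T i)) ⁻¹' {true}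
      = {T | (t : ℝ≥0∞) < T i} := by
    ext T
    simp
  rw [this]
  exact measurableSet_lt measurable_const (measurable_pi_apply i)

lemma measurable_systemFailureTime {Φ : StructureFunction n} (hΦ : Monotone Φ) :
    Measurable (systemFailureTime Φ) := by
  refine measurable_of_Ioi fun c => ?_
  induction c with
  | top => simp
  | coe t =>
    have : systemFailureTime Φ ⁻¹' Ioi (t : ℝ≥0∞)
        = (fun T : Fin n → ℝ≥0∞ => Φ fun i => decide ((t : ℝ≥0∞) < T i)) ⁻¹' {true} := by
      ext T
      exact lt_systemFailureTime_iff hΦ T t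
    rw [this]
    exact (measurable_of_countable Φ).comp (measurable_workingConfiguration t)
      (measurableSet_singleton _)

variable {Ω Ω' : Type*} [MeasurableSpace Ω] [MeasurableSpace Ω'] {P : Measure Ω}
  {P' : Measure Ω'} {L : ℝ≥0 → Ω → ℝ}
  {Φ : Ω' → StructureFunction n} {T : Ω' → Fin n → ℝ≥0∞}

open Classical in
lemma IsMixedCoherent.aemeasurable_systemFailureTime (hΦ : IsMixedCoherent P' Φ)
    (hT : AEMeasurable T P') : AEMeasurable (fun ω => systemFailureTime (Φ ω) (T ω)) P' := by
  have hm : Measurable fun z : (Fin n → ℝ≥0∞) × StructureFunction n =>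
      if Monotone z.2 then systemFailureTime z.2 z.1 else 0 := by
    refine measurable_from_prod_countable_left fun Ψ => ?_
    by_cases hΨ : Monotone Ψ
    · simpa [hΨ] using measurable_systemFailureTime hΨ
    · simp [hΨ]
  refine (hm.comp_aemeasurable (hT.prodMk hΦ.measurable.aemeasurable)).congr ?_
  filter_upwards [hΦ.coherent] with ω hω
  simp [hω.monotone_apply]

lemma prod_ite_eq_pow (x : Fin n → Bool) (p : ℝ) :
    ∏ i, (if x i = true then p else 1 - p)
      = p ^ (Finset.univ.filter fun i => x i = true).card
        * (1 - p) ^ (n - (Finset.univ.filter fun i => x i = true).card) := by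
  rw [Finset.prod_ite, Finset.prod_const, Finset.prod_const]
  congr 2
  have h := Finset.card_filter_add_card_filter_not (s := (Finset.univ : Finset (Fin n)))
    (fun i => x i = true)
  rw [Finset.card_univ, Fintype.card_fin] at h
  omega

/-- Grouping the configurations by their number of working components turns the reliability
polynomial of the system into the Bernstein polynomial of its working proportions. -/
lemma sum_mul_prod_eq_sum_bernstein (p : unitInterval) :
    ∑ x : Fin n → Bool, (∫ ω, (if Φ ω x = true then (1 : ℝ) else 0) ∂P')
        * ∏ i, (if x i = true then (p : ℝ) else 1 - p)
      = ∑ k : Fin (n + 1), bernstein n k p * workingProportion P' Φ k := by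
  rw [← Finset.sum_range fun k => bernstein n k p * workingProportion P' Φ k,
    ← Finset.sum_fiberwise_of_maps_to (t := Finset.range (n + 1))
    (g := fun x : Fin n → Bool => (Finset.univ.filter fun i => x i = true).card)]
  · refine Finset.sum_congr rfl fun k hk => ?_
    have hc : (n.choose k : ℝ) ≠ 0 := by
      exact_mod_cast (Nat.choose_pos (Nat.lt_succ_iff.1 (Finset.mem_range.1 hk))).ne'
    rw [workingProportion, bernstein_apply, mul_div_assoc', Finset.mul_sum, Finset.sum_div]
    refine Finset.sum_congr rfl fun x hx => ?_
    rw [prod_ite_eq_pow, (Finset.mem_filter.1 hx).2]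
    field_simp
  · intro x _
    rw [Finset.mem_range, Nat.lt_succ_iff]
    exact (Finset.card_le_univ _).trans_eq (Fintype.card_fin n)

/-- The probability that the system survives beyond time `t` is the expectation of the Bernstein
polynomial of its working proportions at the point `exp (-L_t)`. -/
lemma measure_lt_systemFailureTime [IsProbabilityMeasure P] [IsProbabilityMeasure P']
    (hL : IsLevySubordinator P L) (hΦ : IsMixedCoherent P' Φ) (hT : HasLFMODistribution P L P' T)
    (hΦT : IndepFun Φ T P') (t : ℝ≥0) :
    P' {ω | (t : ℝ≥0∞) < systemFailureTime (Φ ω) (T ω)}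
      = ENNReal.ofReal (∫ ω, ∑ k : Fin (n + 1), bernstein n k (survivalProbability L t ω)
        * workingProportion P' Φ k ∂P) := by
  set conf : (Fin n → ℝ≥0∞) → Fin n → Bool := fun T i => decide ((t : ℝ≥0∞) < T i)
  have hcm : Measurable conf := measurable_workingConfiguration t
  have hTm : AEMeasurable T P' := hT.aemeasurable_fst
  have hΦm : AEMeasurable Φ P' := hΦ.measurable.aemeasurable
  have hA : P' {ω | (t : ℝ≥0∞) < systemFailureTime (Φ ω) (T ω)}
      = P' {ω | Φ ω (conf (T ω)) = true} := by
    refine measure_congr ?_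
    filter_upwards [hΦ.coherent] with ω hω
    exact propext (lt_systemFailureTime_iff hω.monotone_apply (T ω) t)
  have hAm : NullMeasurableSet {ω | Φ ω (conf (T ω)) = true} P' :=
    ((measurable_of_countable fun z : StructureFunction n × (Fin n → Bool) =>
      z.1 z.2).comp_aemeasurable
      (hΦm.prodMk (hcm.comp_aemeasurable hTm))).nullMeasurableSet_preimage
      (measurableSet_singleton true)
  have hind : P'.real {ω | Φ ω (conf (T ω)) = true}
      = ∫ ω, (if Φ ω (conf (T ω)) = true then (1 : ℝ) else 0) ∂P' := by
    have : (fun ω => if Φ ω (conf (T ω)) = true then (1 : ℝ) else 0)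
        = {ω | Φ ω (conf (T ω)) = true}.indicator fun _ => (1 : ℝ) := by
      funext ω
      simp [indicator]
    rw [this, integral_indicator₀ hAm]
    simp
  have hsplit : ∀ ω, (if Φ ω (conf (T ω)) = true then (1 : ℝ) else 0)
      = ∑ x : Fin n → Bool, (if Φ ω x = true then (1 : ℝ) else 0)
        * (if conf (T ω) = x then (1 : ℝ) else 0) := by
    intro ω
    simp
  have hv : ∀ x : Fin n → Bool,
      Measurable fun S : Fin n → ℝ≥0∞ => if conf S = x then (1 : ℝ) else 0 := fun x =>
    (measurable_of_countable fun y : Fin n → Bool => if y = x then (1 : ℝ) else 0).comp hcm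
  have hu : ∀ x : Fin n → Bool,
      Measurable fun Ψ : StructureFunction n => if Ψ x = true then (1 : ℝ) else 0 :=
    fun x => measurable_of_countable _
  have hlaw : ∀ x : Fin n → Bool, ∫ ω, (if conf (T ω) = x then (1 : ℝ) else 0) ∂P'
      = ∫ ω, ∏ i, (if x i = true then (survivalProbability L t ω : ℝ)
        else 1 - survivalProbability L t ω) ∂P := fun x =>
    ((hT.comp (hv x)).integral_eq).trans (hL.integral_configuration t x)
  have hbdd : ∀ x : Fin n → Bool, Integrable (fun ω => ∏ i, (if x i = true
      then (survivalProbability L t ω : ℝ) else 1 - survivalProbability L t ω)) P := by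
    intro x
    have hp := hL.measurable_survivalProbability t
    refine Integrable.of_bound (C := 1) (((Continuous.measurable (f := fun p : unitInterval =>
      ∏ i, (if x i = true then (p : ℝ) else 1 - p)) ?_).comp hp).aestronglyMeasurable)
      (Eventually.of_forall fun ω => ?_)
    · refine continuous_finsetProd _ fun i _ => ?_
      cases x i
      · simp only [Bool.false_eq_true, if_false]
        exact continuous_const.sub continuous_subtype_val
      · simpa only [if_true] using continuous_subtype_val
    · rw [norm_prod]
      refine Finset.prod_le_one (fun _ _ => norm_nonneg _) fun i _ => ?_
      have h0 := (survivalProbability L t ω).2.1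
      have h1 := (survivalProbability L t ω).2.2
      rw [Real.norm_eq_abs, abs_le]
      split_ifs <;> constructor <;> linarith
  rw [hA, ← ofReal_measureReal, hind]
  congr 1
  simp only [hsplit, ← sum_mul_prod_eq_sum_bernstein]
  rw [integral_finsetSum, integral_finsetSum]
  · refine Finset.sum_congr rfl fun x _ => ?_
    rw [integral_const_mul, ← hlaw]
    exact (hΦT.comp (hu x) (hv x)).integral_fun_mul_eq_mul_integral
      ((hu x).comp_aemeasurable hΦm).aestronglyMeasurable
      ((hv x).comp_aemeasurable hTm).aestronglyMeasurable
  · exact fun x _ => (hbdd x).const_mul _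
  · intro x _
    refine Integrable.of_bound (C := 1) (((hu x).comp_aemeasurable hΦm).mul
      ((hv x).comp_aemeasurable hTm)).aestronglyMeasurable (Eventually.of_forall fun ω => ?_)
    split_ifs <;> simp

end System

/-! ### The limit law -/

section Limit

variable {Ω Ω' : Type*} [MeasurableSpace Ω] [MeasurableSpace Ω'] {P : Measure Ω}
  {P' : Measure Ω'} {L : ℝ≥0 → Ω → ℝ} {f : ℝ → ℝ} {π : Ω' → Ω} {Q : Ω' → ℝ}

lemma ae_mem_Ioo_withDensity (hsupp : ∀ q, q ∉ Ioo (0 : ℝ) 1 → f q = 0) :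
    ∀ᵐ q ∂(volume.withDensity fun q => ENNReal.ofReal (f q)), q ∈ Ioo (0 : ℝ) 1 := by
  rw [ae_iff]
  change (volume.withDensity fun q => ENNReal.ofReal (f q)) (Ioo (0 : ℝ) 1)ᶜ = 0
  rw [withDensity_apply _ measurableSet_Ioo.compl]
  rw [setLIntegral_congr_fun (g := fun _ => 0) measurableSet_Ioo.compl fun q hq => by
    simp [hsupp q hq]]
  simp

lemma isProbabilityMeasure_withDensity_ofReal (h0 : ∀ q, 0 ≤ f q) (hint : Integrable f)
    (h1 : ∫ q, f q = 1) :
    IsProbabilityMeasure (volume.withDensity fun q => ENNReal.ofReal (f q)) := by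
  constructor
  rw [withDensity_apply _ MeasurableSet.univ, Measure.restrict_univ,
    ← ofReal_integral_eq_lintegral_ofReal hint (Eventually.of_forall h0), h1, ENNReal.ofReal_one]

lemma lt_neg_log_one_sub_iff {ℓ q : ℝ} (hq : q < 1) :
    ℓ < -Real.log (1 - q) ↔ 1 - Real.exp (-ℓ) < q := by
  rw [lt_neg, Real.log_lt_iff_lt_exp (by linarith)]
  constructor <;> intro h <;> linarith

/-- For `Q` with density `f`, the event `ℓ < -log (1 - Q)` is the event `1 - exp (-ℓ) < Q`. -/
lemma withDensity_lt_neg_log (h0 : ∀ q, 0 ≤ f q) (hint : Integrable f)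
    (hsupp : ∀ q, q ∉ Ioo (0 : ℝ) 1 → f q = 0) {ℓ : ℝ} {p : unitInterval}
    (hp : (p : ℝ) = Real.exp (-ℓ)) :
    (volume.withDensity fun q => ENNReal.ofReal (f q)) {q | ℓ < -Real.log (1 - q)}
      = ENNReal.ofReal (tailFunction f hint p) := by
  have hp1 : 1 - (p : ℝ) ≤ 1 := by linarith [p.2.1]
  have hset : {q : ℝ | ℓ < -Real.log (1 - q)}
      =ᵐ[volume.withDensity fun q => ENNReal.ofReal (f q)] Ioc (1 - (p : ℝ)) 1 := by
    filter_upwards [ae_mem_Ioo_withDensity hsupp] with q hq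
    refine propext ((lt_neg_log_one_sub_iff hq.2).trans ?_)
    rw [hp]
    exact ⟨fun h => ⟨h, hq.2.le⟩, fun h => h.1⟩
  rw [measure_congr hset, withDensity_apply _ measurableSet_Ioc,
    ← ofReal_integral_eq_lintegral_ofReal hint.integrableOn (Eventually.of_forall h0)]
  simp [tailFunction, intervalIntegral.integral_of_le hp1]

lemma measurable_neg_log_one_sub : Measurable fun q : ℝ => -Real.log (1 - q) :=
  (Real.measurable_log.comp (measurable_const.sub measurable_id)).neg

namespace IsIndepWithDensity

lemma ae_mem_Ioo (h : IsIndepWithDensity P L f P' π Q)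
    (hsupp : ∀ q, q ∉ Ioo (0 : ℝ) 1 → f q = 0) : ∀ᵐ ω ∂P', Q ω ∈ Ioo (0 : ℝ) 1 := by
  have := ae_mem_Ioo_withDensity hsupp
  rw [← h.density.map_eq] at this
  exact ae_of_ae_map h.density.aemeasurable this

lemma aemeasurable_firstPassageTime (h : IsIndepWithDensity P L f P' π Q)
    (hL : IsLevySubordinator P L) :
    AEMeasurable (fun ω => firstPassageTime (fun s => L s (π ω)) (-Real.log (1 - Q ω))) P' := by
  have hb : AEMeasurable (fun ω => -Real.log (1 - Q ω)) P' :=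
    measurable_neg_log_one_sub.comp_aemeasurable h.density.aemeasurable
  have hm : Measurable fun z : Ω × ℝ => ⨅ r : ℚ, if 0 < Real.toNNReal r ∧
      z.2 < L (Real.toNNReal r) z.1 then (Real.toNNReal r : ℝ≥0∞) else ⊤ := by
    refine Measurable.iInf fun r => Measurable.ite ?_ measurable_const measurable_const
    exact (MeasurableSet.const _).inter
      (measurableSet_lt measurable_snd ((hL.measurable _).comp measurable_fst))
  refine (hm.comp_aemeasurable (h.extension.measurable.aemeasurable.prodMk hb)).congr ?_
  filter_upwards [h.extension.quasiMeasurePreserving.ae hL.monotone_paths] with ω hω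
  exact (firstPassageTime_eq_iInf_rat hω _).symm

variable [IsProbabilityMeasure P']

lemma map_prodMk (h : IsIndepWithDensity P L f P' π Q) (hL : IsLevySubordinator P L) (t : ℝ≥0) :
    P'.map (fun ω => (L t (π ω), Q ω))
      = (P.map (L t)).prod (volume.withDensity fun q => ENNReal.ofReal (f q)) := by
  have hm : Measurable fun ω => L t (π ω) := (hL.measurable t).comp h.extension.measurable
  have hi : IndepFun (fun ω => L t (π ω)) Q P' :=
    h.indep.comp (measurable_pi_apply t) measurable_id
  rw [hi.map_prod_eq_prod_map_map hm.aemeasurable h.density.aemeasurable, h.density.map_eq,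
    ← h.extension.map_eq, Measure.map_map (hL.measurable t) h.extension.measurable]
  rfl

lemma measure_lt_neg_log [IsProbabilityMeasure P] (h : IsIndepWithDensity P L f P' π Q)
    (hL : IsLevySubordinator P L) (h0 : ∀ q, 0 ≤ f q) (hint : Integrable f)
    (hsupp : ∀ q, q ∉ Ioo (0 : ℝ) 1 → f q = 0) (t : ℝ≥0) :
    P' {ω | L t (π ω) < -Real.log (1 - Q ω)}
      = ENNReal.ofReal (∫ ω, tailFunction f hint (survivalProbability L t ω) ∂P) := by
  have hms : MeasurableSet {z : ℝ × ℝ | z.1 < -Real.log (1 - z.2)} :=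
    measurableSet_lt measurable_fst (measurable_neg_log_one_sub.comp measurable_snd)
  have hpair : AEMeasurable (fun ω => (L t (π ω), Q ω)) P' :=
    ((hL.measurable t).comp h.extension.measurable).aemeasurable.prodMk h.density.aemeasurable
  have e1 : P' {ω | L t (π ω) < -Real.log (1 - Q ω)}
      = P'.map (fun ω => (L t (π ω), Q ω)) {z | z.1 < -Real.log (1 - z.2)} :=
    (Measure.map_apply_of_aemeasurable hpair hms).symm
  have hG : ∀ x, 0 ≤ tailFunction f hint x := fun x =>
    intervalIntegral.integral_nonneg (by linarith [x.2.1]) fun q _ => h0 q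
  rw [e1, h.map_prodMk hL, Measure.prod_apply hms,
    lintegral_map (measurable_measure_prodMk_left hms) (hL.measurable t),
    ofReal_integral_eq_lintegral_ofReal _ (Eventually.of_forall fun ω => hG _)]
  · refine lintegral_congr_ae ?_
    filter_upwards [hL.ae_coe_survivalProbability t] with ω hp
    exact withDensity_lt_neg_log h0 hint hsupp hp
  · exact Integrable.of_bound ((tailFunction f hint).continuous.measurable.comp
      (hL.measurable_survivalProbability t)).aestronglyMeasurable ‖tailFunction f hint‖
      (Eventually.of_forall fun ω => (tailFunction f hint).norm_coe_le_norm _)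

/-- The level `-log (1 - Q)` has no atoms and is independent of `L`, so it almost surely differs
from `L_t`. -/
lemma ae_neg_log_ne [IsProbabilityMeasure P] (h : IsIndepWithDensity P L f P' π Q)
    (hL : IsLevySubordinator P L) (hsupp : ∀ q, q ∉ Ioo (0 : ℝ) 1 → f q = 0) (t : ℝ≥0) :
    ∀ᵐ ω ∂P', -Real.log (1 - Q ω) ≠ L t (π ω) := by
  have hms : MeasurableSet {z : ℝ × ℝ | -Real.log (1 - z.2) ≠ z.1} :=
    (measurableSet_eq_fun (measurable_neg_log_one_sub.comp measurable_snd) measurable_fst).compl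
  have hpair : AEMeasurable (fun ω => (L t (π ω), Q ω)) P' :=
    ((hL.measurable t).comp h.extension.measurable).aemeasurable.prodMk h.density.aemeasurable
  have key : ∀ᵐ z ∂(P'.map fun ω => (L t (π ω), Q ω)),
      z ∈ {z : ℝ × ℝ | -Real.log (1 - z.2) ≠ z.1} := by
    rw [h.map_prodMk hL, Measure.ae_prod_mem_iff_ae_ae_mem hms]
    refine Eventually.of_forall fun ℓ => ?_
    have hne : ∀ᵐ q ∂(volume.withDensity fun q => ENNReal.ofReal (f q)),
        q ≠ 1 - Real.exp (-ℓ) := by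
      rw [ae_iff]
      simp
    filter_upwards [hne, ae_mem_Ioo_withDensity hsupp] with q hq hq1 heq
    apply hq
    have : Real.log (1 - q) = -ℓ := by linarith
    rw [← this, Real.exp_log (by linarith [hq1.2])]
    ring
  exact ae_of_ae_map hpair key

lemma measure_lt_firstPassageTime [IsProbabilityMeasure P] (h : IsIndepWithDensity P L f P' π Q)
    (hL : IsLevySubordinator P L) (hsupp : ∀ q, q ∉ Ioo (0 : ℝ) 1 → f q = 0) {t : ℝ≥0}
    (ht : 0 < t) :
    P' {ω | (t : ℝ≥0∞) < firstPassageTime (fun s => L s (π ω)) (-Real.log (1 - Q ω))}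
      = P' {ω | L t (π ω) < -Real.log (1 - Q ω)} := by
  refine measure_congr ?_
  filter_upwards [h.ae_neg_log_ne hL hsupp t,
    h.extension.quasiMeasurePreserving.ae hL.monotone_paths,
    h.extension.quasiMeasurePreserving.ae hL.right_continuous] with ω hne hm hc
  exact propext (lt_firstPassageTime_iff hm ht (hc t) hne)

end IsIndepWithDensity

/-- The product extension: `Q` is the second coordinate on `Ω × ℝ`. -/
lemma isIndepWithDensity_prod [IsProbabilityMeasure P] (hL : IsLevySubordinator P L)
    [IsProbabilityMeasure (volume.withDensity fun q => ENNReal.ofReal (f q))] :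
    IsIndepWithDensity P L f (P.prod (volume.withDensity fun q => ENNReal.ofReal (f q)))
      Prod.fst Prod.snd where
  extension := measurePreserving_fst
  density := ⟨measurable_snd.aemeasurable, measurePreserving_snd.map_eq⟩
  indep := indepFun_prod (X := fun ω t => L t ω) (Y := id)
    (measurable_pi_lambda _ hL.measurable) measurable_id

end Limit

end Reliability

theorem corollary1
    -- the common underlying subordinator
    {Ω : Type u} [MeasurableSpace Ω] (P : Measure Ω) [IsProbabilityMeasure P]
    (L : ℝ≥0 → Ω → ℝ) (hL : IsLevySubordinator P L)
    -- for each `n ≥ 1`, a mixed coherent system with `n` components, chosen independently of the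
    -- failure times of the components
    (Ωs : ℕ+ → Type v) [∀ n, MeasurableSpace (Ωs n)]
    (Ps : ∀ n, Measure (Ωs n)) [∀ n, IsProbabilityMeasure (Ps n)]
    (Φ : ∀ n : ℕ+, Ωs n → StructureFunction n) (hΦ : ∀ n, IsMixedCoherent (Ps n) (Φ n))
    (T : ∀ n : ℕ+, Ωs n → Fin n → ℝ≥0∞) (hT : ∀ n, HasLFMODistribution P L (Ps n) (T n))
    (hΦT : ∀ n, IndepFun (Φ n) (T n) (Ps n))
    -- pointwise convergence of the rescaled signatures
    (f : ℝ → ℝ) (hf : Measurable f) (hf_supp : ∀ q, q ∉ Ioo (0 : ℝ) 1 → f q = 0)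
    (hC : ∀ q ∈ Ioo (0 : ℝ) 1,
      Tendsto (fun n : ℕ+ => (n : ℝ) * signature (Ps n) (Φ n) ⌈(n : ℝ) * q⌉₊) atTop (𝓝 (f q)))
    -- domination
    (g : ℝ → ℝ) (hg : IntegrableOn g (Ioo 0 1))
    (hD : ∀ q ∈ Ioo (0 : ℝ) 1, ∀ n : ℕ+,
      (n : ℝ) * signature (Ps n) (Φ n) ⌈(n : ℝ) * q⌉₊ ≤ g q) :
    -- `f` is a probability density
    ((∀ q, 0 ≤ f q) ∧ Integrable f ∧ ∫ q, f q = 1) ∧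
    -- there is a random variable `Q` with density `f`, independent of `L`
    (∃ (Ω' : Type u) (_ : MeasurableSpace Ω') (P' : Measure Ω') (_ : IsProbabilityMeasure P')
      (π : Ω' → Ω) (Q : Ω' → ℝ), IsIndepWithDensity P L f P' π Q) ∧
    -- and for every such `Q` the limits hold
    (∀ (Ω' : Type w) [MeasurableSpace Ω'] (P' : Measure Ω') [IsProbabilityMeasure P']
      (π : Ω' → Ω) (Q : Ω' → ℝ), IsIndepWithDensity P L f P' π Q →
      (∀ᵐ ω ∂P', Q ω ∈ Ioo (0 : ℝ) 1) ∧
      (∀ t : ℝ≥0, 0 < t →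
        Tendsto (fun n => Ps n {ω | (t : ℝ≥0∞) < systemFailureTime (Φ n ω) (T n ω)}) atTop
          (𝓝 (P' {ω | (t : ℝ≥0∞) <
            firstPassageTime (fun s => L s (π ω)) (-Real.log (1 - Q ω))})) ∧
        Tendsto (fun n => Ps n {ω | (t : ℝ≥0∞) < systemFailureTime (Φ n ω) (T n ω)}) atTop
          (𝓝 (P' {ω | L t (π ω) < -Real.log (1 - Q ω)}))) ∧
      TendstoInDistribution (fun n ω => systemFailureTime (Φ n ω) (T n ω)) atTop
        (fun ω => firstPassageTime (fun s => L s (π ω)) (-Real.log (1 - Q ω))) Ps P') := by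
  have hD' : DominatedSignatures (fun n => workingProportion (Ps n) (Φ n))
      (fun n => signature (Ps n) (Φ n)) f g :=
    { sub_eq := fun _ _ => rfl
      zero := fun n => (hΦ n).workingProportion_zero n.pos
      self := fun n => (hΦ n).workingProportion_self n.pos
      nonneg := fun n _ hk hkn => (hΦ n).signature_nonneg hk hkn
      measurable := hf
      support := hf_supp
      tendsto := hC
      integrableOn := hg
      le := hD }
  have h0 := hD'.density_nonneg
  have hint := hD'.integrable_density
  have h1 := hD'.integral_density
  have := isProbabilityMeasure_withDensity_ofReal h0 hint h1
  refine ⟨⟨h0, hint, h1⟩, ⟨Ω × ℝ, inferInstance,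
    P.prod (volume.withDensity fun q => ENNReal.ofReal (f q)), inferInstance, Prod.fst, Prod.snd,
    isIndepWithDensity_prod hL⟩, ?_⟩
  intro Ω' _ P' _ π Q hQ
  have hlim : ∀ t : ℝ≥0,
      Tendsto (fun n => Ps n {ω | (t : ℝ≥0∞) < systemFailureTime (Φ n ω) (T n ω)}) atTop
        (𝓝 (P' {ω | L t (π ω) < -Real.log (1 - Q ω)})) := by
    intro t
    rw [hQ.measure_lt_neg_log hL h0 hint hf_supp t]
    simp only [fun n => measure_lt_systemFailureTime hL (hΦ n) (hT n) (hΦT n) t]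
    exact ENNReal.tendsto_ofReal
      (hD'.tendsto_integral_bernstein P (hL.measurable_survivalProbability t))
  have hlim' : ∀ t : ℝ≥0, 0 < t →
      Tendsto (fun n => Ps n {ω | (t : ℝ≥0∞) < systemFailureTime (Φ n ω) (T n ω)}) atTop
        (𝓝 (P' {ω | (t : ℝ≥0∞) <
          firstPassageTime (fun s => L s (π ω)) (-Real.log (1 - Q ω))})) := fun t ht => by
    rw [hQ.measure_lt_firstPassageTime hL hf_supp ht]
    exact hlim t
  exact ⟨hQ.ae_mem_Ioo hf_supp, fun t ht => ⟨hlim' t ht, hlim t⟩,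
    tendstoInDistribution_of_tendsto_tail
      (fun n => (hΦ n).aemeasurable_systemFailureTime (hT n).aemeasurable_fst)
      (hQ.aemeasurable_firstPassageTime hL) hlim'⟩
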